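/- Let $n,m\ge 0$ and $K=\{1,\dots,m\}$. Write $\mathbb S^n_+$ for the cone of positive semidefinite matrices in the space $\mathbb S^n$ of real symmetric $n\times n$ matrices, and $A\bullet B=\sum_{i,j=1}^n A_{ij}B_{ij}$. For every $t\ge 0$ let $A_0(t),A_1(t),\dots,A_m(t)\in\mathbb S^n$ and $b(t)\in\mathbb R^m$ be given, all continuous at $t=0$, and put $A_k=A_k(0)$, $b=b(0)$. Consider the semidefinite programs $$\text{(P)}\quad \sup_{y,Z}\Big\{b^Ty : A_0-\sum_{k\in K}y_kA_k=Z,\ y\in\mathbb R^m,\ Z\in\mathbb S^n_+\Big\},$$ $$\text{(D$_t$)}\quad \inf_X\big\{A_0(t)\bullet X : A_k(t)\bullet X=b_k(t)\ (k\in K),\ X\in\mathbb S^n_+\big\},$$ and let (D) be (D$_0$). Suppose that (P) has a feasible point $(y,Z)$ with $Z$ positive definite, that (D) has a positive definite feasible point, and that for all sufficiently small $t>0$ the problem (D$_t$) is feasible and $$\operatorname{rank}\langle A_1(t),\dots,A_m(t)\rangle=\operatorname{rank}\langle A_1,\dots,A_m\rangle,$$ where $\operatorname{rank}\langle\cdots\rangle$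 denotes the dimension of the linear span. (Linear independence of the $A_k$ is not assumed.) Then the optimal value of (D$_t$) is finite for all sufficiently small $t\ge 0$, and, as a function of $t\ge 0$, it is continuous at $t=0$. -/

import Mathlib

open Filter Topology
open scoped NNReal

/-- The inner product `A • B = ∑ i j, A i j * B i j` of two real `n × n` matrices. -/
def matInner {n : ℕ} (A B : Matrix (Fin n) (Fin n) ℝ) : ℝ :=
  ∑ i, ∑ j, A i j * B i j

/-- The data `(A₀, A₁, …, Aₘ, b)` of a semidefinite program: symmetric matrices and a vector. -/
structure SDP (n m : ℕ) where
  /-- the matrix `A₀` -/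
  A₀ : Matrix (Fin n) (Fin n) ℝ
  /-- the matrices `A₁, …, Aₘ` -/
  A : Fin m → Matrix (Fin n) (Fin n) ℝ
  /-- the vector `b` -/
  b : Fin m → ℝ
  A₀_symm : A₀.IsSymm
  A_symm : ∀ k, (A k).IsSymm

namespace SDP

variable {n m : ℕ}

/-- The feasible points `(y, Z)` of the primal problem (P):
`sup {bᵀy : A₀ - ∑ k, yₖ Aₖ = Z, Z positive semidefinite}`. -/
def primalFeasibleSet (S : SDP n m) : Set ((Fin m → ℝ) × Matrix (Fin n) (Fin n) ℝ) :=
  {p | S.A₀ - ∑ k, p.1 k • S.A k = p.2 ∧ p.2.PosSemidef}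

/-- The feasible points `X` of the dual problem (D):
`inf {A₀ • X : Aₖ • X = bₖ for all k, X positive semidefinite}`. -/
def dualFeasibleSet (S : SDP n m) : Set (Matrix (Fin n) (Fin n) ℝ) :=
  {X | (∀ k, matInner (S.A k) X = S.b k) ∧ X.PosSemidef}

/-- (P) has a feasible point `(y, Z)` with `Z` positive definite. -/
def PrimalStrictlyFeasible (S : SDP n m) : Prop :=
  ∃ p ∈ S.primalFeasibleSet, p.2.PosDef

/-- (D) is feasible. -/
def DualFeasible (S : SDP n m) : Prop :=
  S.dualFeasibleSet.Nonempty

/-- (D) has a positive definite feasible point. -/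
def DualStrictlyFeasible (S : SDP n m) : Prop :=
  ∃ X ∈ S.dualFeasibleSet, X.PosDef

/-- The optimal value of (D), an extended real number
(`⊤` if (D) is infeasible, `⊥` if it is unbounded below). -/
noncomputable def dualValue (S : SDP n m) : EReal :=
  ⨅ X ∈ S.dualFeasibleSet, ((matInner S.A₀ X : ℝ) : EReal)

/-- `rank ⟨A₁, …, Aₘ⟩`, the dimension of the linear span of the constraint matrices. -/
noncomputable def constraintRank (S : SDP n m) : ℕ :=
  Module.finrank ℝ (Submodule.span ℝ (Set.range S.A))

end SDP

/-! The value is shown to be upper and lower semicontinuous at 0, each half resting on one Slater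
condition. Upper (`eventually_dualValue_lt`): a nearly optimal X of (D), mixed with a little of a
positive definite feasible point, is positive definite. A small correction in the span of the moving
constraint matrices restores the equations (`exists_tendsto_feasible`). The rank condition and
feasibility of (D_t) let a subfamily of independent constraints imply all the others. Lower
(`eventually_lt_dualValue`): a y with positive definite slack keeps its slack above δI nearby, which
bounds the trace of feasible points with bounded objective. Points of too small a value would then
accumulate at a feasible point of (D) of too small a value. Finiteness is weak duality with that
same y, together with feasibility. -/

section MatInner

variable {n : ℕ}

/-- The inner product `matInner` as a bilinear map. -/
def matInnerBilin (n : ℕ) :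
    Matrix (Fin n) (Fin n) ℝ →ₗ[ℝ] Matrix (Fin n) (Fin n) ℝ →ₗ[ℝ] ℝ :=
  LinearMap.mk₂ ℝ matInner
    (fun A B C => by simp [matInner, add_mul, Finset.sum_add_distrib])
    (fun c A B => by simp [matInner, Finset.mul_sum, mul_assoc])
    (fun A B C => by simp [matInner, mul_add, Finset.sum_add_distrib])
    (fun c A B => by simp [matInner, Finset.mul_sum, mul_left_comm])

theorem matInnerBilin_apply (A B : Matrix (Fin n) (Fin n) ℝ) :
    matInnerBilin n A B = matInner A B := rfl

theorem continuous_matInner :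
    Continuous fun p : Matrix (Fin n) (Fin n) ℝ × Matrix (Fin n) (Fin n) ℝ =>
      matInner p.1 p.2 := by
  unfold matInner
  fun_prop

theorem Filter.Tendsto.matInner {α : Type*} {l : Filter α}
    {f g : α → Matrix (Fin n) (Fin n) ℝ} {A B : Matrix (Fin n) (Fin n) ℝ}
    (hf : Tendsto f l (𝓝 A)) (hg : Tendsto g l (𝓝 B)) :
    Tendsto (fun t => _root_.matInner (f t) (g t)) l (𝓝 (_root_.matInner A B)) :=
  tendsto_finsetSum _ fun i _ => tendsto_finsetSum _ fun j _ =>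
    (((continuous_apply_apply i j).tendsto A).comp hf).mul
      (((continuous_apply_apply i j).tendsto B).comp hg)

theorem eq_zero_of_matInner_self {A : Matrix (Fin n) (Fin n) ℝ} (h : matInner A A = 0) :
    A = 0 := by
  have hn : ∀ i j, 0 ≤ A i j * A i j := fun i j => mul_self_nonneg _
  ext i j
  have h1 := (Finset.sum_eq_zero_iff_of_nonneg
    (fun i _ => Finset.sum_nonneg fun j _ => hn i j)).1 h i (Finset.mem_univ i)
  have h2 := (Finset.sum_eq_zero_iff_of_nonneg (fun j _ => hn i j)).1 h1 j (Finset.mem_univ j)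
  simpa using h2

theorem matInner_one_left (X : Matrix (Fin n) (Fin n) ℝ) : matInner 1 X = X.trace := by
  simp [matInner, Matrix.one_apply, Matrix.trace]

theorem Matrix.PosSemidef.matInner_nonneg {Z X : Matrix (Fin n) (Fin n) ℝ}
    (hZ : Z.PosSemidef) (hX : X.PosSemidef) : 0 ≤ matInner Z X := by
  obtain ⟨m, v, rfl⟩ := Matrix.posSemidef_iff_eq_sum_vecMulVec.1 hX
  rw [← matInnerBilin_apply, map_sum]
  refine Finset.sum_nonneg fun k _ => ?_
  have h := hZ.dotProduct_mulVec_nonneg (v k)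
  rw [matInnerBilin_apply]
  refine h.trans_eq ?_
  simp only [matInner, dotProduct, Matrix.mulVec, Matrix.vecMulVec_apply, Finset.mul_sum,
    Pi.star_apply, star_trivial]
  exact Finset.sum_congr rfl fun i _ => Finset.sum_congr rfl fun j _ => by ring

/-- Turns a trace bound on positive semidefinite matrices into entrywise bounds, hence compactness.
-/
theorem Matrix.PosSemidef.abs_apply_le_trace {X : Matrix (Fin n) (Fin n) ℝ}
    (hX : X.PosSemidef) (i j : Fin n) : |X i j| ≤ X.trace := by
  have hd : ∀ k, X k k ≤ X.trace := fun k =>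
    Finset.single_le_sum (f := fun k => X k k) (fun _ _ => hX.diag_nonneg) (Finset.mem_univ k)
  have hs : X j i = X i j := by simpa using hX.isHermitian.apply i j
  -- Testing with e_i ± e_j gives 2|X i j| ≤ X i i + X j j.
  have h1 := hX.dotProduct_mulVec_nonneg (Pi.single i 1 + Pi.single j 1)
  have h2 := hX.dotProduct_mulVec_nonneg (Pi.single i 1 - Pi.single j 1)
  simp [Matrix.mulVec_add, Matrix.mulVec_sub, add_dotProduct, sub_dotProduct, hs] at h1 h2
  have := hd i
  have := hd j
  rw [abs_le]
  constructor <;> linarith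

theorem isClosed_setOf_posSemidef :
    IsClosed {X : Matrix (Fin n) (Fin n) ℝ | X.PosSemidef} := by
  simp only [Matrix.posSemidef_iff_dotProduct_mulVec, Set.ofPred_and, Set.ofPred_forall]
  refine IsClosed.inter (isClosed_eq ?_ continuous_id) (isClosed_iInter fun x =>
    isClosed_le continuous_const ?_)
  · exact continuous_id.matrix_conjTranspose
  · exact Continuous.dotProduct continuous_const
      (Continuous.matrix_mulVec continuous_id continuous_const)

/-- Positive definiteness is an open condition on Hermitian matrices. -/
theorem Matrix.PosDef.eventually_posDef {Z : Matrix (Fin n) (Fin n) ℝ} (hZ : Z.PosDef) :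
    ∀ᶠ M in 𝓝 Z, M.IsHermitian → M.PosDef := by
  have hc : Continuous fun p : Matrix (Fin n) (Fin n) ℝ × (Fin n → ℝ) =>
      p.2 ⬝ᵥ p.1.mulVec p.2 :=
    continuous_snd.dotProduct (continuous_fst.matrix_mulVec continuous_snd)
  -- Compactness of the unit sphere makes one neighbourhood of Z serve all x; homogeneity then
  -- covers every nonzero x.
  have key : ∀ᶠ M in 𝓝 Z, ∀ x ∈ Metric.sphere (0 : Fin n → ℝ) 1, 0 < x ⬝ᵥ M.mulVec x := by
    refine (isCompact_sphere _ _).eventually_forall_of_forall_eventually fun x hx => ?_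
    refine (hc.tendsto (Z, x)).eventually (lt_mem_nhds ?_)
    have hx0 : x ≠ 0 := by
      rintro rfl
      simp at hx
    simpa using hZ.dotProduct_mulVec_pos hx0
  filter_upwards [key] with M hM hH
  refine .of_dotProduct_mulVec_pos hH fun x hx => ?_
  have hpos : 0 < ‖x‖ := norm_pos_iff.2 hx
  have h := hM (‖x‖⁻¹ • x) (by simp [norm_smul, hpos.ne'])
  rw [Matrix.mulVec_smul, smul_dotProduct, dotProduct_smul, smul_eq_mul, smul_eq_mul] at h
  have h' := pos_of_mul_pos_right h (by positivity)
  simpa using pos_of_mul_pos_right h' (by positivity)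

/-- A positive definite matrix stays uniformly positive definite under small Hermitian
perturbations. -/
theorem Matrix.PosDef.exists_eventually_posDef_sub_smul_one {Z : Matrix (Fin n) (Fin n) ℝ}
    (hZ : Z.PosDef) :
    ∃ δ > (0 : ℝ), ∀ᶠ M in 𝓝 Z, M.IsHermitian → (M - δ • (1 : Matrix _ _ ℝ)).PosDef := by
  have hherm : ∀ (δ : ℝ) {M : Matrix (Fin n) (Fin n) ℝ}, M.IsHermitian →
      (M - δ • (1 : Matrix _ _ ℝ)).IsHermitian := fun δ M hM => by
    refine hM.sub ?_
    simp [Matrix.IsHermitian]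
  have h1 : Tendsto (fun δ : ℝ => Z - δ • (1 : Matrix (Fin n) (Fin n) ℝ)) (𝓝[>] 0) (𝓝 Z) := by
    have : Continuous fun δ : ℝ => Z - δ • (1 : Matrix (Fin n) (Fin n) ℝ) := by fun_prop
    simpa using (this.tendsto 0).mono_left nhdsWithin_le_nhds
  obtain ⟨δ, hδ, hδ0⟩ := ((h1.eventually hZ.eventually_posDef).and self_mem_nhdsWithin).exists
  refine ⟨δ, hδ0, ?_⟩
  have h2 : Tendsto (fun M : Matrix (Fin n) (Fin n) ℝ => M - δ • (1 : Matrix (Fin n) (Fin n) ℝ))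
      (𝓝 Z) (𝓝 (Z - δ • (1 : Matrix (Fin n) (Fin n) ℝ))) :=
    (continuous_id.sub continuous_const).tendsto Z
  filter_upwards [h2.eventually (hδ (hherm δ hZ.isHermitian)).eventually_posDef] with M hM hH
  exact hM (hherm δ hH)

/-! ### Gram matrices and linear equations with varying coefficients -/

/-- The Gram matrix of a finite family of matrices with respect to `matInner`. -/
def matGram {κ : Type*} (a : κ → Matrix (Fin n) (Fin n) ℝ) : Matrix κ κ ℝ :=
  Matrix.of fun i j => matInner (a i) (a j)

theorem matGram_mulVec {κ : Type*} [Fintype κ] (a : κ → Matrix (Fin n) (Fin n) ℝ) (c : κ → ℝ)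
    (k : κ) : (matGram a).mulVec c k = matInner (a k) (∑ j, c j • a j) := by
  rw [← matInnerBilin_apply]
  simp [matGram, Matrix.mulVec, dotProduct, matInnerBilin_apply, mul_comm]

theorem matGram_det_ne_zero_iff {κ : Type*} [Fintype κ] [DecidableEq κ]
    {a : κ → Matrix (Fin n) (Fin n) ℝ} : (matGram a).det ≠ 0 ↔ LinearIndependent ℝ a := by
  rw [Fintype.linearIndependent_iff, Ne, ← Matrix.exists_mulVec_eq_zero_iff]
  push Not
  constructor
  · intro h c hc i
    by_contra hi
    refine h c (fun h0 => hi (by simp [h0])) ?_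
    ext k
    rw [matGram_mulVec, hc, ← matInnerBilin_apply]
    simp
  · intro h c hc0 hc
    refine hc0 (funext (h c (eq_zero_of_matInner_self ?_)))
    have hsum : ∀ M, matInner (∑ j, c j • a j) M = ∑ j, c j * matInner (a j) M := fun M => by
      rw [← matInnerBilin_apply]
      simp [matInnerBilin_apply]
    refine (hsum _).trans (Finset.sum_eq_zero fun k _ => ?_)
    rw [← matGram_mulVec, hc, Pi.zero_apply, mul_zero]

/-- A solution of linear equations with linearly independent coefficient matrices can be
followed continuously when the data of the equations vary. -/
theorem exists_tendsto_matInner_eq {α κ : Type*} [Fintype κ] {l : Filter α}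
    {a : α → κ → Matrix (Fin n) (Fin n) ℝ} {a₀ : κ → Matrix (Fin n) (Fin n) ℝ}
    {b : α → κ → ℝ} {X : Matrix (Fin n) (Fin n) ℝ}
    (ha : ∀ k, Tendsto (fun t => a t k) l (𝓝 (a₀ k)))
    (hb : ∀ k, Tendsto (fun t => b t k) l (𝓝 (matInner (a₀ k) X)))
    (hli : LinearIndependent ℝ a₀) :
    ∃ c : α → κ → ℝ, Tendsto c l (𝓝 0) ∧ ∀ᶠ t in l, LinearIndependent ℝ (a t) ∧
      ∀ k, matInner (a t k) (X + ∑ j, c t j • a t j) = b t k := by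
  classical
  have hG : Tendsto (fun t => matGram (a t)) l (𝓝 (matGram a₀)) :=
    tendsto_pi_nhds.2 fun i => tendsto_pi_nhds.2 fun j => (ha i).matInner (ha j)
  have hdet : Tendsto (fun t => (matGram (a t)).det) l (𝓝 (matGram a₀).det) :=
    ((continuous_id.matrix_det).tendsto _).comp hG
  have hdet0 : (matGram a₀).det ≠ 0 := matGram_det_ne_zero_iff.2 hli
  have hinv : Tendsto (fun t => (matGram (a t))⁻¹) l (𝓝 (matGram a₀)⁻¹) := by
    simp only [Matrix.inv_def, Ring.inverse_eq_inv']
    exact (hdet.inv₀ hdet0).smul (((continuous_id.matrix_adjugate).tendsto _).comp hG)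
  have hr : Tendsto (fun t k => b t k - matInner (a t k) X) l (𝓝 0) := by
    refine tendsto_pi_nhds.2 fun k => ?_
    simpa using (hb k).sub ((ha k).matInner (tendsto_const_nhds (x := X)))
  -- The correction solves G(t) c = residual of X; the residual tends to 0 and G(t)⁻¹ converges, so
  -- c tends to 0.
  refine ⟨fun t => (matGram (a t))⁻¹.mulVec fun k => b t k - matInner (a t k) X, ?_, ?_⟩
  · have hm : Continuous fun p : Matrix κ κ ℝ × (κ → ℝ) => p.1.mulVec p.2 :=
      continuous_fst.matrix_mulVec continuous_snd
    have h := (hm.tendsto ((matGram a₀)⁻¹, 0)).comp (hinv.prodMk_nhds hr)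
    rwa [Matrix.mulVec_zero] at h
  · filter_upwards [hdet.eventually_ne hdet0] with t ht
    refine ⟨matGram_det_ne_zero_iff.1 ht, fun k => ?_⟩
    rw [← matInnerBilin_apply, map_add, matInnerBilin_apply, matInnerBilin_apply,
      ← matGram_mulVec, Matrix.mulVec_mulVec, Matrix.mul_nonsing_inv _ (isUnit_iff_ne_zero.2 ht),
      Matrix.one_mulVec]
    ring

end MatInner

/-! ### Weak duality and semicontinuity of the optimal value -/

namespace SDP

variable {n m : ℕ}

/-- The slack matrix `A₀ - ∑ k, yₖ Aₖ`. -/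
def slack (S : SDP n m) (y : Fin m → ℝ) : Matrix (Fin n) (Fin n) ℝ :=
  S.A₀ - ∑ k, y k • S.A k

theorem slack_isHermitian (S : SDP n m) (y : Fin m → ℝ) : (S.slack y).IsHermitian := by
  have h : (S.slack y).IsSymm := by
    simp only [slack, Matrix.IsSymm, Matrix.transpose_sub, Matrix.transpose_sum,
      Matrix.transpose_smul, S.A₀_symm.eq, (S.A_symm _).eq]
  rw [Matrix.IsHermitian, Matrix.conjTranspose_eq_transpose_of_trivial, h.eq]

theorem matInner_slack (S : SDP n m) (y : Fin m → ℝ) {X : Matrix (Fin n) (Fin n) ℝ}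
    (hX : X ∈ S.dualFeasibleSet) :
    matInner (S.slack y) X = matInner S.A₀ X - ∑ k, y k * S.b k := by
  rw [← matInnerBilin_apply]
  simp [slack, matInnerBilin_apply, hX.1]

theorem le_dualValue {S : SDP n m} {c : ℝ}
    (h : ∀ X ∈ S.dualFeasibleSet, c ≤ matInner S.A₀ X) : (c : EReal) ≤ S.dualValue :=
  le_iInf₂ fun X hX => EReal.coe_le_coe_iff.2 (h X hX)

theorem dualValue_le {S : SDP n m} {X : Matrix (Fin n) (Fin n) ℝ}
    (hX : X ∈ S.dualFeasibleSet) : S.dualValue ≤ (matInner S.A₀ X : ℝ) :=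
  iInf₂_le X hX

/-- Weak duality. -/
theorem dualValue_ne_bot {S : SDP n m} {y : Fin m → ℝ} (hy : (S.slack y).PosSemidef) :
    S.dualValue ≠ ⊥ := by
  refine ((EReal.bot_lt_coe _).trans_le
    (le_dualValue (c := ∑ k, y k * S.b k) fun X hX => ?_)).ne'
  linarith [hy.matInner_nonneg hX.2, S.matInner_slack y hX]

theorem DualFeasible.dualValue_ne_top {S : SDP n m} (h : S.DualFeasible) :
    S.dualValue ≠ ⊤ := by
  obtain ⟨X, hX⟩ := h
  exact ((dualValue_le hX).trans_lt (EReal.coe_lt_top _)).ne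

theorem PrimalStrictlyFeasible.exists_slack {S : SDP n m} (h : S.PrimalStrictlyFeasible) :
    ∃ y, (S.slack y).PosDef := by
  obtain ⟨⟨y, Z⟩, ⟨hZ, -⟩, hpd⟩ := h
  exact ⟨y, by rw [slack, hZ]; exact hpd⟩

theorem tendsto_slack {α : Type*} {l : Filter α} {S : α → SDP n m} {S₀ : SDP n m}
    (hA₀ : Tendsto (fun t => (S t).A₀) l (𝓝 S₀.A₀))
    (hA : ∀ k, Tendsto (fun t => (S t).A k) l (𝓝 (S₀.A k))) (y : Fin m → ℝ) :
    Tendsto (fun t => (S t).slack y) l (𝓝 (S₀.slack y)) :=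
  hA₀.sub (tendsto_finsetSum _ fun k _ => tendsto_const_nhds.smul (hA k))

/-- A point satisfying the constraints indexed by a family that
spans all constraint matrices satisfies all constraints, provided these are consistent. -/
theorem matInner_eq_of_span {S : SDP n m} {κ : Type*} {f : κ → Fin m}
    {X Y : Matrix (Fin n) (Fin n) ℝ} (hY : Y ∈ S.dualFeasibleSet)
    (hf : Submodule.span ℝ (Set.range (S.A ∘ f)) = Submodule.span ℝ (Set.range S.A))
    (hX : ∀ k, matInner (S.A (f k)) X = S.b (f k)) (k : Fin m) :
    matInner (S.A k) X = S.b k := by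
  -- X - Y is orthogonal to the subfamily, hence to its span, which contains every constraint
  -- matrix.
  have hle : Submodule.span ℝ (Set.range (S.A ∘ f)) ≤
      LinearMap.ker ((matInnerBilin n).flip (X - Y)) := by
    rw [Submodule.span_le]
    rintro _ ⟨i, rfl⟩
    simp [matInnerBilin_apply, hX, hY.1]
  have := hle (hf.symm ▸ Submodule.subset_span (Set.mem_range_self k))
  simp only [LinearMap.mem_ker, map_sub, LinearMap.sub_apply, LinearMap.flip_apply,
    matInnerBilin_apply, hY.1] at this
  linarith

/-- Positive definite feasible points of the limit program are limits of feasible points. -/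
theorem exists_tendsto_feasible {α : Type*} {l : Filter α} {S : α → SDP n m} {S₀ : SDP n m}
    (hA : ∀ k, Tendsto (fun t => (S t).A k) l (𝓝 (S₀.A k)))
    (hb : Tendsto (fun t => (S t).b) l (𝓝 S₀.b))
    (hfeas : ∀ᶠ t in l, (S t).DualFeasible)
    (hrank : ∀ᶠ t in l, (S t).constraintRank = S₀.constraintRank)
    {X : Matrix (Fin n) (Fin n) ℝ} (hX : X ∈ S₀.dualFeasibleSet) (hpd : X.PosDef) :
    ∃ Y : α → Matrix (Fin n) (Fin n) ℝ, Tendsto Y l (𝓝 X) ∧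
      ∀ᶠ t in l, Y t ∈ (S t).dualFeasibleSet := by
  -- Only a basis chosen among the limit constraints is tracked, since the Gram matrix of the whole
  -- family may be singular.
  obtain ⟨κ, f, hf, hspan, hli⟩ := exists_linearIndependent' ℝ S₀.A
  have : Finite κ := Finite.of_injective f hf
  have := Fintype.ofFinite κ
  obtain ⟨c, hc, hev⟩ := exists_tendsto_matInner_eq (a := fun t k => (S t).A (f k))
    (b := fun t k => (S t).b (f k)) (X := X) (fun k => hA (f k))
    (fun k => by
      simpa only [Function.comp_apply, hX.1] using tendsto_pi_nhds.1 hb (f k)) hli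
  have hY : Tendsto (fun t => X + ∑ j, c t j • (S t).A (f j)) l (𝓝 X) := by
    simpa using tendsto_const_nhds.add (tendsto_finsetSum Finset.univ fun j _ =>
      (tendsto_pi_nhds.1 hc j).smul (hA (f j)))
  refine ⟨_, hY, ?_⟩
  filter_upwards [hev, hfeas, hrank, hY.eventually hpd.eventually_posDef]
    with t ⟨hlt, ht⟩ ⟨W, hW⟩ hr hpdt
  refine ⟨matInner_eq_of_span (f := f) hW ?_ ht, (hpdt ?_).posSemidef⟩
  -- The tracked matrices stay independent, so by constancy of rank they still span all constraints
  -- at t.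
  · refine Submodule.eq_of_le_of_finrank_eq
      (Submodule.span_mono (Set.range_comp_subset_range _ _)) ?_
    refine (finrank_span_eq_card hlt).trans (((finrank_span_eq_card hli).symm.trans ?_).trans
      hr.symm)
    rw [hspan, constraintRank]
  · refine hpd.isHermitian.add ?_
    simp only [Matrix.IsHermitian, Matrix.conjTranspose_eq_transpose_of_trivial,
      Matrix.transpose_sum, Matrix.transpose_smul, ((S t).A_symm _).eq]

/-- Upper semicontinuity of the optimal value. -/
theorem eventually_dualValue_lt {α : Type*} {l : Filter α} {S : α → SDP n m} {S₀ : SDP n m}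
    (hA₀ : Tendsto (fun t => (S t).A₀) l (𝓝 S₀.A₀))
    (hA : ∀ k, Tendsto (fun t => (S t).A k) l (𝓝 (S₀.A k)))
    (hb : Tendsto (fun t => (S t).b) l (𝓝 S₀.b))
    (hD : S₀.DualStrictlyFeasible)
    (hfeas : ∀ᶠ t in l, (S t).DualFeasible)
    (hrank : ∀ᶠ t in l, (S t).constraintRank = S₀.constraintRank)
    {v : EReal} (hv : S₀.dualValue < v) : ∀ᶠ t in l, (S t).dualValue < v := by
  obtain ⟨r, hr, hrv⟩ := EReal.lt_iff_exists_real_btwn.1 hv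
  obtain ⟨X, hX, hXr⟩ : ∃ X ∈ S₀.dualFeasibleSet, matInner S₀.A₀ X < r := by
    simpa [dualValue, iInf_lt_iff] using hr
  obtain ⟨W, hW, hWpd⟩ := hD
  have hcont : Continuous fun δ : ℝ => matInner S₀.A₀ ((1 - δ) • X + δ • W) :=
    continuous_matInner.comp (by fun_prop : Continuous fun δ : ℝ =>
      (S₀.A₀, (1 - δ) • X + δ • W))
  have hδ : ∀ᶠ δ in 𝓝[>] (0 : ℝ), matInner S₀.A₀ ((1 - δ) • X + δ • W) < r :=
    (hcont.tendsto 0).mono_left nhdsWithin_le_nhds |>.eventually (gt_mem_nhds (by simpa))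
  obtain ⟨δ, hδr, hδ0, hδ1⟩ := (hδ.and (Ioo_mem_nhdsGT zero_lt_one)).exists
  have hpd : ((1 - δ) • X + δ • W).PosDef :=
    Matrix.PosDef.posSemidef_add (hX.2.smul (sub_nonneg.2 hδ1.le)) (hWpd.smul hδ0)
  have hmem : (1 - δ) • X + δ • W ∈ S₀.dualFeasibleSet := by
    refine ⟨fun k => ?_, hpd.posSemidef⟩
    rw [← matInnerBilin_apply]
    simp only [map_add, map_smul, matInnerBilin_apply, hX.1, hW.1, smul_eq_mul]
    ring
  obtain ⟨Y, hY, hYf⟩ := exists_tendsto_feasible hA hb hfeas hrank hmem hpd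
  filter_upwards [hYf, (hA₀.matInner hY).eventually (gt_mem_nhds hδr)] with t ht htr
  exact (dualValue_le ht).trans_lt ((EReal.coe_lt_coe_iff.2 htr).trans hrv)

/-- Lower semicontinuity of the optimal value. -/
theorem eventually_lt_dualValue {α : Type*} {l : Filter α} {S : α → SDP n m} {S₀ : SDP n m}
    (hA₀ : Tendsto (fun t => (S t).A₀) l (𝓝 S₀.A₀))
    (hA : ∀ k, Tendsto (fun t => (S t).A k) l (𝓝 (S₀.A k)))
    (hb : Tendsto (fun t => (S t).b) l (𝓝 S₀.b))
    (hP : S₀.PrimalStrictlyFeasible)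
    {v : EReal} (hv : v < S₀.dualValue) : ∀ᶠ t in l, v < (S t).dualValue := by
  obtain ⟨r, hvr, hr⟩ := EReal.lt_iff_exists_real_btwn.1 hv
  suffices h : ∀ᶠ t in l, ∀ X ∈ (S t).dualFeasibleSet, r ≤ matInner (S t).A₀ X from
    h.mono fun t ht => hvr.trans_le (le_dualValue ht)
  by_contra hne
  -- An ultrafilter plays the role of a convergent subsequence of counterexamples.
  obtain ⟨U, hUl, hU⟩ : ∃ U : Ultrafilter α, ↑U ≤ l ∧
      ∀ᶠ t in (U : Filter α), ∃ X ∈ (S t).dualFeasibleSet, matInner (S t).A₀ X < r := by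
    have := Filter.frequently_iff_neBot.1 (Filter.not_eventually.1 hne)
    have hle := Ultrafilter.of_le (l ⊓ 𝓟 {t | ¬ ∀ X ∈ (S t).dualFeasibleSet,
      r ≤ matInner (S t).A₀ X})
    refine ⟨Ultrafilter.of _, hle.trans inf_le_left, ?_⟩
    filter_upwards [Filter.le_principal_iff.1 (hle.trans inf_le_right)] with t ht
    simpa using ht
  obtain ⟨X, hX⟩ := hU.choice
  obtain ⟨y, hy⟩ := hP.exists_slack
  obtain ⟨δ, hδ, hslack⟩ := hy.exists_eventually_posDef_sub_smul_one
  have hbsum : Tendsto (fun t => ∑ k, y k * (S t).b k) U (𝓝 (∑ k, y k * S₀.b k)) :=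
    tendsto_finsetSum _ fun k _ => (tendsto_pi_nhds.1 (hb.mono_left hUl) k).const_mul _
  obtain ⟨C, hC⟩ : ∃ C : ℝ, ∀ᶠ t in (U : Filter α), (X t).trace ≤ C := by
    -- From δ tr X ≤ slack • X = A₀ • X - bᵀy, with A₀ • X < r and bᵀy above its limit minus 1.
    refine ⟨(r - (∑ k, y k * S₀.b k - 1)) / δ, ?_⟩
    filter_upwards [hX, ((tendsto_slack hA₀ hA y).mono_left hUl).eventually hslack,
      hbsum.eventually (lt_mem_nhds (sub_one_lt _))] with t ht hpd hbt
    have h1 := (hpd (slack_isHermitian _ _)).posSemidef.matInner_nonneg ht.1.2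
    rw [← matInnerBilin_apply] at h1
    simp only [map_sub, map_smul, LinearMap.sub_apply, LinearMap.smul_apply, matInnerBilin_apply,
      matInner_one_left, (S t).matInner_slack y ht.1, smul_eq_mul] at h1
    rw [le_div_iff₀ hδ]
    linarith [ht.2]
  have hK : IsCompact (X := Matrix (Fin n) (Fin n) ℝ) (Set.univ.pi fun _ : Fin n =>
      Set.univ.pi fun _ : Fin n => Set.Icc (-C) C) :=
    isCompact_univ_pi fun _ => isCompact_univ_pi fun _ => isCompact_Icc
  obtain ⟨X₀, -, hX₀⟩ := hK.ultrafilter_le_nhds (U.map X) <| by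
    refine Filter.le_principal_iff.2 (Filter.mem_map.2 ?_)
    filter_upwards [hX, hC] with t ht htC i _ j _
    exact abs_le.1 ((ht.1.2.abs_apply_le_trace i j).trans htC)
  have hlim : Tendsto X U (𝓝 X₀) := hX₀
  have hmem : X₀ ∈ S₀.dualFeasibleSet := by
    refine ⟨fun k => ?_, isClosed_setOf_posSemidef.mem_of_tendsto hlim
      (hX.mono fun t ht => ht.1.2)⟩
    refine tendsto_nhds_unique (((hA k).mono_left hUl).matInner hlim)
      ((tendsto_pi_nhds.1 (hb.mono_left hUl) k).congr' ?_)
    exact hX.mono fun t ht => (ht.1.1 k).symm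
  have hle : matInner S₀.A₀ X₀ ≤ r :=
    le_of_tendsto ((hA₀.mono_left hUl).matInner hlim) (hX.mono fun t ht => ht.2.le)
  exact absurd hr (not_lt.2 ((dualValue_le hmem).trans (EReal.coe_le_coe_iff.2 hle)))

end SDP

theorem theorem3p2 {n m : ℕ} (S : ℝ≥0 → SDP n m)
    (hA₀ : ContinuousAt (fun t => (S t).A₀) 0)
    (hA : ∀ k, ContinuousAt (fun t => (S t).A k) 0)
    (hb : ContinuousAt (fun t => (S t).b) 0)
    (hP : (S 0).PrimalStrictlyFeasible)
    (hD : (S 0).DualStrictlyFeasible)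
    (hfeas : ∀ᶠ t in 𝓝[>] (0 : ℝ≥0), (S t).DualFeasible)
    (hrank : ∀ᶠ t in 𝓝[>] (0 : ℝ≥0), (S t).constraintRank = (S 0).constraintRank) :
    (∀ᶠ t in 𝓝 (0 : ℝ≥0), (S t).dualValue ≠ ⊥ ∧ (S t).dualValue ≠ ⊤) ∧
      ContinuousAt (fun t => (S t).dualValue) 0 := by
  -- In `ℝ≥0` a neighbourhood of 0 is 0 together with a right neighbourhood, so conditions for t > 0
  -- need only be checked at 0 as well.
  have hext : ∀ {p : ℝ≥0 → Prop}, (∀ᶠ t in 𝓝[>] 0, p t) → p 0 → ∀ᶠ t in 𝓝 0, p t := by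
    intro p hp h0
    have hIoi : ({0}ᶜ : Set ℝ≥0) = Set.Ioi 0 := Set.ext fun t => pos_iff_ne_zero.symm
    rw [← nhdsNE_sup_pure, hIoi]
    exact Filter.eventually_sup.2 ⟨hp, h0⟩
  have hfeas' : ∀ᶠ t in 𝓝 0, (S t).DualFeasible :=
    hext hfeas (hD.imp fun X hX => hX.1)
  have hrank' : ∀ᶠ t in 𝓝 0, (S t).constraintRank = (S 0).constraintRank := hext hrank rfl
  refine ⟨?_, tendsto_order.2 ⟨fun v hv => SDP.eventually_lt_dualValue hA₀ hA hb hP hv,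
    fun v hv => SDP.eventually_dualValue_lt hA₀ hA hb hD hfeas' hrank' hv⟩⟩
  obtain ⟨y, hy⟩ := hP.exists_slack
  filter_upwards [hfeas', (SDP.tendsto_slack hA₀ hA y).eventually hy.eventually_posDef]
    with t ht hpd
  exact ⟨SDP.dualValue_ne_bot (hpd (SDP.slack_isHermitian _ _)).posSemidef, ht.dualValue_ne_top⟩
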